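/- Let $k$ be an algebraically closed field, $\Lambda$ an associative $k$-algebra with unit, and $\operatorname{mod}\Lambda$ the category of left $\Lambda$-modules that are finite dimensional over $k$; $\dim$ means $\dim_k$. Let $V_1,\dots,V_l$ ($l\ge 0$) be pairwise nonisomorphic indecomposable modules in $\operatorname{mod}\Lambda$, let $n_1,\dots,n_l\ge 0$ be integers, let $B=\bigoplus_{i=1}^l V_i^{n_i}$, and let $f:A\to B$ and $g:B\to C$ be morphisms in $\operatorname{mod}\Lambda$ with components $f_{ij}:A\to V_i$ and $g_{ij}:V_i\to C$, $1\le j\le n_i$. Let $W_i$ be the $k$-space with basis $e_{i1},\dots,e_{in_i}$, and define the morphisms $$T:\bigoplus_{i=1}^l V_i\otimes_k W_i\to C,\quad T(v\otimes e_{ij})=g_{ij}(v),\qquad\qquad S:A\to\bigoplus_{i=1}^l V_i\otimes_k W_i,\quad S(a)=\Bigl(\sum_{j} f_{ij}(a)\otimes e_{ij}\Bigr)_{i}.$$ Terminology. A linear map has *maximal rank* if it is injective or surjective. $T$ has the *right omnipresent maximal rank property* if for all subspaces $W_i'\subseteq W_i$ the restriction of $T$ to $\bigoplus_i V_i\otimes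 W_i'$ has maximal rank; $S$ has it if for all subspaces $W_i'\subseteq W_i$ the composition of $S$ with the projection $\bigoplus_i V_i\otimes W_i\to\bigoplus_i V_i\otimes (W_i/W_i')$ has maximal rank. A property holds *for a general choice of subspaces* $U_i\subseteq V_i$ if, for every choice of dimensions $d_1,\dots,d_l$, it holds for all $(U_1,\dots,U_l)$ in some dense Zariski open subset of the product of Grassmannians $\prod_i G(d_i,V_i)$. The morphism $g$ is *right almost split* if it is not a split epimorphism and every morphism $X\to C$ in $\operatorname{mod}\Lambda$ that is not a split epimorphism factors through $g$; it is *minimal* if every endomorphism $\theta$ of $B$ with $g\theta=g$ is an automorphism. Dually, $f$ is *left almost split* if it is not a split monomorphism and every morphism $A\to X$ in $\operatorname{mod}\Lambda$ that is not a split monomorphism factors through $f$; it is *minimal* if every endomorphism $\theta$ of $B$ with $\theta f=f$ is an automorphism. An exact sequence $0\to A\xrightarrow{f}B\xrightarrow{g}C\to0$ is *almost split* if $f$ is left almost split and $g$ is right almost split. If $g$ is minimal right almost split in $\operatorname{mod}\Lambda$, then: (a) $T$ has the right omnipresent maximal rank property. (b) For a general choice of $k$-subspaces $U_i\subseteq V_i$,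 the restriction of $g$ to $\bigoplus_i U_i^{n_i}$ has maximal rank. (c) If $g$ is surjective, then $\dim C<\sum_{i=1}^l(\dim V_i)^2$. If $f$ is minimal left almost split in $\operatorname{mod}\Lambda$, then: (d) $S$ has the right omnipresent maximal rank property. (e) For a general choice of $k$-subspaces $U_i\subseteq V_i$, with natural projections $\sigma_i:V_i\to V_i/U_i$, the linear map $\bigl(\bigoplus_i\sigma_i^{n_i}\bigr)\circ f$ has maximal rank. (f) If $f$ is injective, then $\dim A<\sum_{i=1}^l(\dim V_i)^2$. If $0\to A\xrightarrow{f}B\xrightarrow{g}C\to0$ is an almost split sequence in $\operatorname{mod}\Lambda$, then: (g) $\dim B<2\sum_{i=1}^l(\dim V_i)^2-1$. -/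

import Mathlib

open scoped TensorProduct

universe u v w

namespace AlmostSplitRank

/-! ### Modules and almost split morphisms

`k` is a field, `Λ` a `k`-algebra. An object of `mod Λ` is a left `Λ`-module which is finite
dimensional over `k` (for the `k`-structure coming from `Λ`, which is what `IsScalarTower k Λ X`
says). Morphisms of `mod Λ` are the `Λ`-linear maps. -/

section AlmostSplit

variable {Λ : Type v} [Ring Λ]

/-- A nonzero module that is not the direct sum of two nonzero submodules. -/
def IsIndecomposable (Λ : Type v) [Ring Λ] (M : Type w) [AddCommGroup M] [Module Λ M] : Prop :=
  Nontrivial M ∧ ∀ N N' : Submodule Λ M, IsCompl N N' → N = ⊥ ∨ N' = ⊥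

variable {A B C : Type w} [AddCommGroup A] [Module Λ A] [AddCommGroup B] [Module Λ B]
  [AddCommGroup C] [Module Λ C]

/-- `g` is a split epimorphism. -/
def IsSplitEpi (g : B →ₗ[Λ] C) : Prop :=
  ∃ s : C →ₗ[Λ] B, g ∘ₗ s = LinearMap.id

/-- `f` is a split monomorphism. -/
def IsSplitMono (f : A →ₗ[Λ] B) : Prop :=
  ∃ r : B →ₗ[Λ] A, r ∘ₗ f = LinearMap.id

variable (k : Type u) [Field k] [Algebra k Λ]

/-- `g : B → C` is right almost split in `mod Λ`: it is not a split epimorphism, and every morphism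
`h : X → C` of `mod Λ` that is not a split epimorphism factors through `g`. -/
def IsRightAlmostSplit (g : B →ₗ[Λ] C) : Prop :=
  ¬ IsSplitEpi g ∧
    ∀ (X : Type w) [AddCommGroup X] [Module k X] [Module Λ X] [IsScalarTower k Λ X]
      [FiniteDimensional k X] (h : X →ₗ[Λ] C),
      ¬ IsSplitEpi h → ∃ t : X →ₗ[Λ] B, g ∘ₗ t = h

/-- `f : A → B` is left almost split in `mod Λ`: it is not a split monomorphism, and every morphism
`h : A → X` of `mod Λ` that is not a split monomorphism factors through `f`. -/
def IsLeftAlmostSplit (f : A →ₗ[Λ] B) : Prop :=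
  ¬ IsSplitMono f ∧
    ∀ (X : Type w) [AddCommGroup X] [Module k X] [Module Λ X] [IsScalarTower k Λ X]
      [FiniteDimensional k X] (h : A →ₗ[Λ] X),
      ¬ IsSplitMono h → ∃ t : B →ₗ[Λ] X, t ∘ₗ f = h

/-- Right almost split and right minimal: every endomorphism `θ` of `B` with `g θ = g` is an
automorphism. -/
def IsMinimalRightAlmostSplit (g : B →ₗ[Λ] C) : Prop :=
  IsRightAlmostSplit k g ∧ ∀ θ : B →ₗ[Λ] B, g ∘ₗ θ = g → Function.Bijective θ

/-- Left almost split and left minimal: every endomorphism `θ` of `B` with `θ f = f` is an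
automorphism. -/
def IsMinimalLeftAlmostSplit (f : A →ₗ[Λ] B) : Prop :=
  IsLeftAlmostSplit k f ∧ ∀ θ : B →ₗ[Λ] B, θ ∘ₗ f = f → Function.Bijective θ

/-- `0 → A → B → C → 0` is an almost split sequence: it is exact, `f` is left almost split and
`g` is right almost split. -/
def IsAlmostSplitSequence (f : A →ₗ[Λ] B) (g : B →ₗ[Λ] C) : Prop :=
  Function.Injective f ∧ Function.Exact f g ∧ Function.Surjective g ∧
    IsLeftAlmostSplit k f ∧ IsRightAlmostSplit k g

end AlmostSplit

/-! ### Maximal rank properties of linear maps -/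

section MaximalRank

variable {k : Type u} [Field k]

/-- A linear map has maximal rank if it is injective or surjective. -/
def HasMaximalRank {E F : Type*} [AddCommGroup E] [Module k E] [AddCommGroup F] [Module k F]
    (φ : E →ₗ[k] F) : Prop :=
  Function.Injective φ ∨ Function.Surjective φ

variable {ι : Type*} {V W : ι → Type*}
  [∀ i, AddCommGroup (V i)] [∀ i, Module k (V i)] [∀ i, AddCommGroup (W i)] [∀ i, Module k (W i)]

/-- The right omnipresent maximal rank property of `T : ⨁ Vᵢ ⊗ Wᵢ → U`: for all subspaces
`W'ᵢ ⊆ Wᵢ`, the restriction of `T` to `⨁ Vᵢ ⊗ W'ᵢ` has maximal rank. -/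
def RightOmnipresentFrom {U : Type*} [AddCommGroup U] [Module k U]
    (T : (∀ i, V i ⊗[k] W i) →ₗ[k] U) : Prop :=
  ∀ W' : ∀ i, Submodule k (W i),
    HasMaximalRank (T ∘ₗ LinearMap.piMap fun i => (W' i).subtype.lTensor (V i))

/-- The right omnipresent maximal rank property of `S : Q → ⨁ Vᵢ ⊗ Wᵢ`: for all subspaces
`W'ᵢ ⊆ Wᵢ`, the composition of `S` with `⨁ Vᵢ ⊗ Wᵢ → ⨁ Vᵢ ⊗ (Wᵢ / W'ᵢ)` has maximal rank. -/
def RightOmnipresentInto {Q : Type*} [AddCommGroup Q] [Module k Q]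
    (S : Q →ₗ[k] ∀ i, V i ⊗[k] W i) : Prop :=
  ∀ W' : ∀ i, Submodule k (W i),
    HasMaximalRank ((LinearMap.piMap fun i => (W' i).mkQ.lTensor (V i)) ∘ₗ S)

end MaximalRank

/-! ### General choices of subspaces -/

section General

variable (k : Type u) [Field k]

/-- The polynomial functions on a vector space: the algebra of functions generated by the linear
functionals. -/
def polyFunctions (E : Type*) [AddCommGroup E] [Module k E] : Subalgebra k (E → k) :=
  Algebra.adjoin k (Set.range fun (φ : Module.Dual k E) (x : E) => φ x)

/-- The Zariski topology on a (finite dimensional) vector space: the nonvanishing loci of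
polynomial functions are a basis of the open sets. -/
@[reducible] def zariskiTopology (E : Type*) [AddCommGroup E] [Module k E] : TopologicalSpace E :=
  TopologicalSpace.generateFrom
    {D : Set E | ∃ p ∈ polyFunctions k E, D = {x | p x ≠ 0}}

variable {ι : Type*} (V : ι → Type*) [∀ i, AddCommGroup (V i)] [∀ i, Module k (V i)]

/-- The points of the product `∏ G(dᵢ, Vᵢ)` of Grassmannians of `dᵢ`-dimensional subspaces. -/
def GrassmannianProduct (d : ι → ℕ) : Type _ :=
  {U : ∀ i, Submodule k (V i) // ∀ i, Module.finrank k (U i) = d i}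

/-- Families of `dᵢ`-frames (linearly independent `dᵢ`-tuples) in the spaces `Vᵢ`. -/
def FrameProduct (d : ι → ℕ) : Type _ :=
  {x : ∀ i, Fin (d i) → V i // ∀ i, LinearIndependent k (x i)}

/-- The Zariski topology on families of frames, as a subset of the vector space `∏ Vᵢ ^ dᵢ`. -/
instance (d : ι → ℕ) : TopologicalSpace (FrameProduct k V d) :=
  TopologicalSpace.induced Subtype.val (zariskiTopology k (∀ i, Fin (d i) → V i))

/-- The spans of a family of frames. -/
def FrameProduct.span {d : ι → ℕ} (x : FrameProduct k V d) : GrassmannianProduct k V d :=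
  ⟨fun i => Submodule.span k (Set.range (x.1 i)), fun i => by
    rw [finrank_span_eq_card (x.2 i), Fintype.card_fin]⟩

/-- The Zariski topology on `∏ G(dᵢ, Vᵢ)`, as the quotient of the variety of families of frames by
the group `∏ GL(dᵢ)`: a set of families of subspaces is open if and only if the set of families of
frames spanning its members is open. -/
instance (d : ι → ℕ) : TopologicalSpace (GrassmannianProduct k V d) :=
  TopologicalSpace.coinduced (FrameProduct.span k V) inferInstance

variable {V}

/-- `P` holds for a general choice of subspaces `Uᵢ ⊆ Vᵢ`: once the dimensions of the `Uᵢ` are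
fixed, `P` holds on a dense Zariski open subset of the product of Grassmannians. -/
def ForGeneralSubspaces (P : (∀ i, Submodule k (V i)) → Prop) : Prop :=
  ∀ d : ι → ℕ, ∃ O : Set (GrassmannianProduct k V d), IsOpen O ∧ Dense O ∧ ∀ U ∈ O, P U.1

end General

/-! ### The maps `T` and `S` -/

section Maps

variable (k : Type u) [Field k] {Λ : Type v} [Ring Λ] [Algebra k Λ] {l : ℕ} {n : Fin l → ℕ}
  {V : Fin l → Type w} [∀ i, AddCommGroup (V i)] [∀ i, Module k (V i)] [∀ i, Module Λ (V i)]
  [∀ i, IsScalarTower k Λ (V i)]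
  {A C : Type w} [AddCommGroup A] [Module Λ A] [AddCommGroup C] [Module Λ C]

/-- The `k`-space `W` with a basis `e₁, …, eₘ`. -/
abbrev MultSpace (m : ℕ) : Type u := Fin m → k

/-- The basis vector `eⱼ` of `MultSpace k m`. -/
def basisVec {m : ℕ} (j : Fin m) : MultSpace k m := Pi.single j 1

/-- The morphism `X ⊗ W → X`, `x ⊗ (∑ cⱼ eⱼ) ↦ cⱼ x`. -/
noncomputable def tensorCoord (X : Type w) [AddCommGroup X] [Module k X] [Module Λ X]
    [IsScalarTower k Λ X] {m : ℕ} (j : Fin m) : X ⊗[k] MultSpace k m →ₗ[Λ] X :=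
  (TensorProduct.AlgebraTensorModule.rid k Λ X).toLinearMap ∘ₗ
    TensorProduct.AlgebraTensorModule.map LinearMap.id (LinearMap.proj j)

/-- The morphism `X → X ⊗ W`, `x ↦ x ⊗ eⱼ`. -/
noncomputable def tensorIncl (X : Type w) [AddCommGroup X] [Module k X] [Module Λ X]
    [IsScalarTower k Λ X] {m : ℕ} (j : Fin m) : X →ₗ[Λ] X ⊗[k] MultSpace k m where
  toFun x := x ⊗ₜ[k] basisVec k j
  map_add' x y := TensorProduct.add_tmul x y _
  map_smul' _ _ := rfl

/-- The component `gᵢⱼ : Vᵢ → C` of `g : ⨁ Vᵢ ^ nᵢ → C`. -/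
def compFrom (g : (∀ i, Fin (n i) → V i) →ₗ[Λ] C) (i : Fin l) (j : Fin (n i)) : V i →ₗ[Λ] C :=
  g ∘ₗ LinearMap.single Λ (fun i => Fin (n i) → V i) i ∘ₗ LinearMap.single Λ (fun _ => V i) j

/-- The component `fᵢⱼ : A → Vᵢ` of `f : A → ⨁ Vᵢ ^ nᵢ`. -/
def compInto (f : A →ₗ[Λ] ∀ i, Fin (n i) → V i) (i : Fin l) (j : Fin (n i)) : A →ₗ[Λ] V i :=
  LinearMap.proj j ∘ₗ LinearMap.proj i ∘ₗ f

/-- The morphism `T : ⨁ Vᵢ ⊗ Wᵢ → C` with `T (v ⊗ eᵢⱼ) = gᵢⱼ v`. -/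
noncomputable def mapT (g : (∀ i, Fin (n i) → V i) →ₗ[Λ] C) :
    (∀ i, V i ⊗[k] MultSpace k (n i)) →ₗ[Λ] C :=
  ∑ i, (∑ j, compFrom g i j ∘ₗ tensorCoord k (V i) j) ∘ₗ LinearMap.proj i

/-- The morphism `S : A → ⨁ Vᵢ ⊗ Wᵢ` with `i`-th component `a ↦ ∑ⱼ fᵢⱼ a ⊗ eᵢⱼ`. -/
noncomputable def mapS (f : A →ₗ[Λ] ∀ i, Fin (n i) → V i) :
    A →ₗ[Λ] ∀ i, V i ⊗[k] MultSpace k (n i) :=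
  LinearMap.pi fun i => ∑ j, tensorIncl k (V i) j ∘ₗ compInto f i j

variable {k}

/-- The subspace `⨁ Uᵢ ^ nᵢ` of `⨁ Vᵢ ^ nᵢ`. -/
def powSubspace (n : Fin l → ℕ) (U : ∀ i, Submodule k (V i)) :
    Submodule k (∀ i, Fin (n i) → V i) :=
  Submodule.pi Set.univ fun i => Submodule.pi Set.univ fun _ => U i

/-- The linear map `⨁ σᵢ ^ nᵢ : ⨁ Vᵢ ^ nᵢ → ⨁ (Vᵢ / Uᵢ) ^ nᵢ`, where `σᵢ : Vᵢ → Vᵢ / Uᵢ` is the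
natural projection. -/
def powMkQ (n : Fin l → ℕ) (U : ∀ i, Submodule k (V i)) :
    (∀ i, Fin (n i) → V i) →ₗ[k] ∀ i, Fin (n i) → V i ⧸ U i :=
  LinearMap.piMap fun i => LinearMap.piMap fun _ => (U i).mkQ

end Maps

end AlmostSplitRank

open AlmostSplitRank

/-! Omnipresence comes from minimality. Subspaces `W'ᵢ ⊆ Wᵢ` cut out a direct summand `p : B' → B`
with retraction `q`. If `g ∘ p` is not onto, the inclusion of its image is not a split epimorphism,
so it lifts to some `t` along `g`. The endomorphism `t (g p) q + (1 - p q)` is then fixed by `g`,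
hence bijective, and it agrees with `p` up to terms that die on `ker (g p)`; so `g p` is injective.
The statement for `f` is dual.

General subspaces are parametrized by frames `x`. Restricting `g` to the span of `x` becomes a map
on a fixed space of coefficients `c` that depends linearly on `x`. At a frame of maximal rank, every
derivative of the family sends the kernel into the range. If `c ≠ 0` lies in the kernel, the
combinations with coefficients `c` of all families of vectors fill some `⨁ Vᵢ ⊗ W'ᵢ`. There `g` is
not injective, so by omnipresence it is onto, and its values are exactly such derivatives; hence the
range is everything. Openness of maximal rank and irreducibility of the frame variety give density.

For the dimension bounds, an element of `⨁ Vᵢ ⊗ Wᵢ` already lies in some `⨁ Vᵢ ⊗ W'ᵢ` with `dim W'ᵢ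
≤ dim Vᵢ`, a space of dimension at most `∑ (dim Vᵢ)²`. Were `dim C` at least this sum, maximal rank
would force `g` to be injective, so a surjective `g` would split. For `f` the same count is applied
to a functional on `B` vanishing on the image of `f`. In an almost split sequence both maps are
minimal, and the two bounds add up. -/

namespace AlmostSplitRank

/-! ### Polynomial functions and the Zariski topology. -/

section Polynomial

variable {k : Type u} [Field k] {E : Type*} [AddCommGroup E] [Module k E]

theorem dual_mem_polyFunctions (φ : Module.Dual k E) : (fun x => φ x) ∈ polyFunctions k E :=
  Algebra.subset_adjoin ⟨φ, rfl⟩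

theorem const_mem_polyFunctions (c : k) : (fun _ : E => c) ∈ polyFunctions k E :=
  (polyFunctions k E).algebraMap_mem c

/-- The restriction of a polynomial function to a line is a polynomial. -/
theorem exists_polynomial_on_line {p : E → k} (hp : p ∈ polyFunctions k E) (x y : E) :
    ∃ q : Polynomial k, ∀ t : k, p (x + t • y) = q.eval t := by
  induction hp using Algebra.adjoin_induction with
  | mem p hp =>
    obtain ⟨φ, rfl⟩ := hp
    exact ⟨.C (φ x) + .C (φ y) * .X, fun t => by simp [mul_comm t]⟩
  | algebraMap c => exact ⟨.C c, fun t => by simp⟩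
  | add p p' _ _ h h' =>
    obtain ⟨q, hq⟩ := h
    obtain ⟨q', hq'⟩ := h'
    exact ⟨q + q', fun t => by simp [hq, hq']⟩
  | mul p p' _ _ h h' =>
    obtain ⟨q, hq⟩ := h
    obtain ⟨q', hq'⟩ := h'
    exact ⟨q * q', fun t => by simp [hq, hq']⟩

/-- Two polynomial functions that do not vanish at `x` are nonzero at a further point of each line
through `x`. -/
theorem exists_ne_zero_on_line [Infinite k] {p q : E → k} (hp : p ∈ polyFunctions k E)
    (hq : q ∈ polyFunctions k E) (x y : E) (hpx : p x ≠ 0) (hqx : q x ≠ 0) :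
    ∃ t : k, t ≠ 0 ∧ p (x + t • y) ≠ 0 ∧ q (x + t • y) ≠ 0 := by
  obtain ⟨P, hP⟩ := exists_polynomial_on_line hp x y
  obtain ⟨Q, hQ⟩ := exists_polynomial_on_line hq x y
  have hP0 : P ≠ 0 := by
    rintro rfl
    exact hpx (by simpa using hP 0)
  have hQ0 : Q ≠ 0 := by
    rintro rfl
    exact hqx (by simpa using hQ 0)
  -- The factor `X` excludes the parameter `t = 0`.
  have hne : Polynomial.X * (P * Q) ≠ 0 := mul_ne_zero Polynomial.X_ne_zero (mul_ne_zero hP0 hQ0)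
  by_contra! h
  refine hne (Polynomial.funext fun t => ?_)
  by_cases ht : t = 0
  · simp [ht]
  · by_cases hPt : P.eval t = 0
    · simp [hPt]
    · simp [← hQ t, h t ht (by rwa [hP t])]

/-- Over an infinite field, nonvanishing loci of polynomial functions meet. -/
theorem exists_common_ne_zero [Infinite k] {p q : E → k} (hp : p ∈ polyFunctions k E)
    (hq : q ∈ polyFunctions k E) {x y : E} (hpx : p x ≠ 0) (hqy : q y ≠ 0) :
    ∃ z, p z ≠ 0 ∧ q z ≠ 0 := by
  -- The line passes through `x` at `t = 0` and through `y` at `t = 1`.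
  obtain ⟨P, hP⟩ := exists_polynomial_on_line hp x (y - x)
  obtain ⟨Q, hQ⟩ := exists_polynomial_on_line hq x (y - x)
  have hP0 : P ≠ 0 := by
    rintro rfl
    exact hpx (by simpa using hP 0)
  have hQ0 : Q ≠ 0 := by
    rintro rfl
    exact hqy (by simpa using hQ 1)
  by_contra! h
  refine mul_ne_zero hP0 hQ0 (Polynomial.funext fun t => ?_)
  by_cases hPt : P.eval t = 0
  · simp [hPt]
  · simp [← hQ t, h _ (by rwa [hP t])]

theorem isTopologicalBasis_zariski :
    @TopologicalSpace.IsTopologicalBasis E (zariskiTopology k E)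
      {D : Set E | ∃ p ∈ polyFunctions k E, D = {x | p x ≠ 0}} := by
  let := zariskiTopology k E
  refine ⟨?_, ?_, rfl⟩
  · rintro _ ⟨p, hp, rfl⟩ _ ⟨q, hq, rfl⟩ x ⟨hx, hx'⟩
    refine ⟨_, ⟨p * q, mul_mem hp hq, rfl⟩, mul_ne_zero hx hx', fun z hz => ?_⟩
    exact ⟨left_ne_zero_of_mul hz, right_ne_zero_of_mul hz⟩
  · refine Set.eq_univ_of_forall fun x => ⟨_, ⟨1, one_mem _, rfl⟩, ?_⟩
    simp

end Polynomial

/-! ### Rank in affine families of linear maps. -/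

section AffineFamily

variable {k : Type u} [Field k] {E : Type*} [AddCommGroup E] [Module k E]
  {P Q : Type*} [AddCommGroup P] [Module k P] [AddCommGroup Q] [Module k Q]

/-- Each matrix entry is a constant plus a linear functional of `x`, and the Leibniz formula is a
polynomial in the entries. -/
theorem det_mem_polyFunctions [FiniteDimensional k P] (F₀ : P →ₗ[k] P) (F : E →ₗ[k] P →ₗ[k] P) :
    (fun x => LinearMap.det (F₀ + F x)) ∈ polyFunctions k E := by
  classical
  let b := Module.finBasis k P
  let M : Matrix _ _ (E → k) := Matrix.of fun i j x => LinearMap.toMatrix b b (F₀ + F x) i j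
  have hM : (fun x => LinearMap.det (F₀ + F x)) = M.det := by
    ext x
    rw [← LinearMap.det_toMatrix b]
    exact ((Pi.evalRingHom (fun _ : E => k) x).map_det M).symm
  rw [hM, Matrix.det_apply]
  refine sum_mem fun σ _ => ?_
  rw [Units.smul_def]
  refine zsmul_mem (prod_mem fun i _ => ?_) _
  convert add_mem (const_mem_polyFunctions (LinearMap.toMatrix b b F₀ (σ i) i))
    (dual_mem_polyFunctions (Matrix.entryLinearMap k k (σ i) i ∘ₗ
      (LinearMap.toMatrix b b).toLinearMap ∘ₗ F)) using 1
  ext x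
  simp [M]

/-- Injectivity is an open condition in an affine family of linear maps. -/
theorem exists_polyFunction_injective [FiniteDimensional k P] (F₀ : P →ₗ[k] Q) (F : E →ₗ[k] P →ₗ[k] Q) {x : E}
    (hx : Function.Injective (F₀ + F x)) :
    ∃ p ∈ polyFunctions k E, p x ≠ 0 ∧ ∀ y, p y ≠ 0 → Function.Injective (F₀ + F y) := by
  obtain ⟨L, hL⟩ := (F₀ + F x).exists_leftInverse_of_injective (LinearMap.ker_eq_bot.2 hx)
  -- With `L` a left inverse at `x`, the determinant of `L ∘ (F₀ + F y)` equals 1 at `y = x`; where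
  -- it is nonzero, `F₀ + F y` is injective.
  refine ⟨_, det_mem_polyFunctions (L ∘ₗ F₀) (LinearMap.compRight k L ∘ₗ F), ?_, fun y hy => ?_⟩
  · simp [← LinearMap.comp_add, hL]
  · have h := (LinearMap.isUnit_iff_isUnit_det _).2 (isUnit_iff_ne_zero.2 hy)
    have h' := ((Module.End.isUnit_iff _).1 h).1
    refine Function.Injective.of_comp (f := L) ?_
    convert h' using 1
    ext; simp

/-- Surjectivity is an open condition in an affine family of linear maps. -/
theorem exists_polyFunction_surjective [FiniteDimensional k Q] (F₀ : P →ₗ[k] Q) (F : E →ₗ[k] P →ₗ[k] Q) {x : E}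
    (hx : Function.Surjective (F₀ + F x)) :
    ∃ p ∈ polyFunctions k E, p x ≠ 0 ∧ ∀ y, p y ≠ 0 → Function.Surjective (F₀ + F y) := by
  obtain ⟨R, hR⟩ := (F₀ + F x).exists_rightInverse_of_surjective (LinearMap.range_eq_top.2 hx)
  refine ⟨_, det_mem_polyFunctions (F₀ ∘ₗ R) (LinearMap.lcomp k Q R ∘ₗ F), ?_, fun y hy => ?_⟩
  · have : F₀ ∘ₗ R + (LinearMap.lcomp k Q R ∘ₗ F) x = (F₀ + F x) ∘ₗ R := by ext; simp
    rw [this, hR]; simp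
  · have h := (LinearMap.isUnit_iff_isUnit_det _).2 (isUnit_iff_ne_zero.2 hy)
    have h' := ((Module.End.isUnit_iff _).1 h).2
    refine Function.Surjective.of_comp (g := R) ?_
    convert h' using 1
    ext; simp

theorem exists_polyFunction_hasMaximalRank [FiniteDimensional k P] [FiniteDimensional k Q]
    (F₀ : P →ₗ[k] Q) (F : E →ₗ[k] P →ₗ[k] Q) {x : E}
    (hx : HasMaximalRank (F₀ + F x)) :
    ∃ p ∈ polyFunctions k E, p x ≠ 0 ∧ ∀ y, p y ≠ 0 → HasMaximalRank (F₀ + F y) := by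
  obtain hx | hx := hx
  · obtain ⟨p, hp, hpx, h⟩ := exists_polyFunction_injective F₀ F hx
    exact ⟨p, hp, hpx, fun y hy => .inl (h y hy)⟩
  · obtain ⟨p, hp, hpx, h⟩ := exists_polyFunction_surjective F₀ F hx
    exact ⟨p, hp, hpx, fun y hy => .inr (h y hy)⟩

/-- Where an affine family of linear maps attains its maximal rank, its derivatives map the kernel
into the range. -/
theorem apply_mem_range_of_rank_max [Infinite k] [FiniteDimensional k Q]
    (F₀ : P →ₗ[k] Q) (F : E →ₗ[k] P →ₗ[k] Q)
    {p : E → k} (hp : p ∈ polyFunctions k E) {x : E} (hpx : p x ≠ 0)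
    (hmax : ∀ z, p z ≠ 0 → Module.finrank k (LinearMap.range (F₀ + F z)) ≤
      Module.finrank k (LinearMap.range (F₀ + F x)))
    (y : E) {a : P} (ha : (F₀ + F x) a = 0) : F y a ∈ LinearMap.range (F₀ + F x) := by
  by_contra hv
  set v := F y a with hv_def
  obtain ⟨r, hr⟩ := (F₀ + F x).rangeRestrict.exists_rightInverse_of_surjective
    (LinearMap.range_rangeRestrict _)
  have hr' : ∀ m, (F₀ + F x) (r m) = m := fun m => congrArg Subtype.val (LinearMap.congr_fun hr m)
  -- Test family on a space of dimension rank plus one: it applies the varying map to the lifts `r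
  -- m` of range vectors and adjoins the direction `v`. It is injective at `x` because `v` lies
  -- outside the range.
  let G₀ : (LinearMap.range (F₀ + F x) × k) →ₗ[k] Q :=
    (F₀ ∘ₗ r).coprod (LinearMap.toSpanSingleton k Q v)
  let G : E →ₗ[k] (LinearMap.range (F₀ + F x) × k) →ₗ[k] Q :=
    LinearMap.lcomp k Q (r ∘ₗ LinearMap.fst k _ k) ∘ₗ F
  have hG : ∀ z m s, (G₀ + G z) (m, s) = (F₀ + F z) (r m) + s • v := fun z m s => by
    simp only [LinearMap.add_apply, G₀, G, LinearMap.coprod_apply, LinearMap.comp_apply,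
      LinearMap.lcomp_apply, LinearMap.fst_apply, LinearMap.toSpanSingleton_apply]
    abel
  have hinj : Function.Injective (G₀ + G x) := by
    refine (injective_iff_map_eq_zero _).2 ?_
    rintro ⟨m, s⟩ h
    rw [hG, hr'] at h
    have hs : s = 0 := by
      by_contra hs
      refine hv ?_
      rw [← inv_smul_smul₀ hs v, eq_neg_of_add_eq_zero_right h]
      exact Submodule.smul_mem _ _ (neg_mem m.2)
    subst hs
    simpa using h
  obtain ⟨q, hq, hqx, hqi⟩ := exists_polyFunction_injective G₀ G hinj
  obtain ⟨t, ht, hpt, hqt⟩ := exists_ne_zero_on_line hp hq x y hpx hqx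
  -- Since `a` is killed at `x`, at `x + t • y` it maps to `t • v`; as `t ≠ 0`, the vector `v`
  -- itself is in the range there, so the rank exceeds the maximum.
  have hle : LinearMap.range (G₀ + G (x + t • y)) ≤ LinearMap.range (F₀ + F (x + t • y)) := by
    rintro _ ⟨⟨m, s⟩, rfl⟩
    refine ⟨r m + (s * t⁻¹) • a, ?_⟩
    have hat : (F₀ + F (x + t • y)) a = t • v := by
      rw [map_add, ← add_assoc, LinearMap.add_apply, ha, zero_add, map_smul, LinearMap.smul_apply]
    rw [hG, map_add, map_smul, hat, smul_smul, inv_mul_cancel_right₀ ht]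
  have h1 := Submodule.finrank_mono hle
  rw [LinearMap.finrank_range_of_inj (hqi _ hqt), Module.finrank_prod, Module.finrank_self] at h1
  have := hmax _ hpt
  omega

end AffineFamily

/-! ### Frames, their irreducibility, and descent to Grassmannians. -/

section Frames

variable {k : Type u} [Field k] {ι : Type*} {V : ι → Type*} [∀ i, AddCommGroup (V i)]
  [∀ i, Module k (V i)]

/-- The bilinear map sending families `xᵢ` of vectors of `Vᵢ` and `cᵢⱼ` of coefficients to the
family of linear combinations `∑ₛ cᵢⱼₛ xᵢₛ`. -/
def comb (k : Type u) [Field k] {ι : Type*} (V : ι → Type*) [∀ i, AddCommGroup (V i)]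
    [∀ i, Module k (V i)] (n d : ι → ℕ) :
    (∀ i, Fin (d i) → V i) →ₗ[k] (∀ i, Fin (n i) → Fin (d i) → k) →ₗ[k] ∀ i, Fin (n i) → V i :=
  LinearMap.mk₂ k (fun x c i j => ∑ s, c i j s • x i s)
    (fun x y c => by ext; simp [Finset.sum_add_distrib])
    (fun t x c => by ext; simp [Finset.smul_sum, smul_comm t])
    (fun x c c' => by ext; simp [add_smul, Finset.sum_add_distrib])
    (fun t x c => by ext; simp [Finset.smul_sum, mul_smul])

theorem comb_apply {n d : ι → ℕ} (x : ∀ i, Fin (d i) → V i) (c : ∀ i, Fin (n i) → Fin (d i) → k)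
    (i : ι) (j : Fin (n i)) : comb k V n d x c i j = ∑ s, c i j s • x i s := rfl

theorem comb_injective (n : ι → ℕ) {d : ι → ℕ} {x : ∀ i, Fin (d i) → V i}
    (hx : ∀ i, LinearIndependent k (x i)) : Function.Injective (comb k V n d x) := by
  refine (injective_iff_map_eq_zero _).2 fun c hc => ?_
  ext i j s
  exact Fintype.linearIndependent_iff.1 (hx i) (c i j) (congrFun (congrFun hc i) j) s

/-- Taking one coefficient row per index encodes independence of all the tuples as injectivity of a
single map, so that openness of injectivity applies to it. -/
theorem linearIndependent_of_comb_injective {d : ι → ℕ} {x : ∀ i, Fin (d i) → V i}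
    (hx : Function.Injective (comb k V (fun _ => 1) d x)) (i : ι) :
    LinearIndependent k (x i) := by
  classical
  refine Fintype.linearIndependent_iff.2 fun c hc s => ?_
  have h : (Pi.single i fun _ => c : ∀ i, Fin 1 → Fin (d i) → k) = 0 := by
    refine (injective_iff_map_eq_zero _).1 hx _ ?_
    ext i' j
    rw [comb_apply]
    obtain rfl | hi := eq_or_ne i' i
    · simpa using hc
    · simp [hi]
  simpa using congrFun (congrFun (congrFun h i) 0) s

/-- Being a family of frames is a Zariski open condition. -/
theorem exists_polyFunction_linearIndependent [Finite ι] {d : ι → ℕ} {x : ∀ i, Fin (d i) → V i}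
    (hx : ∀ i, LinearIndependent k (x i)) :
    ∃ p ∈ polyFunctions k (∀ i, Fin (d i) → V i), p x ≠ 0 ∧
      ∀ y, p y ≠ 0 → ∀ i, LinearIndependent k (y i) := by
  obtain ⟨p, hp, hpx, h⟩ := exists_polyFunction_injective 0 (comb k V (fun _ => 1) d) (x := x)
    (by simpa using comb_injective (fun _ => 1) hx)
  exact ⟨p, hp, hpx, fun y hy => linearIndependent_of_comb_injective (by simpa using h y hy)⟩

theorem FrameProduct.exists_basic_open {d : ι → ℕ} {O : Set (FrameProduct k V d)} (hO : IsOpen O)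
    {x : FrameProduct k V d} (hx : x ∈ O) :
    ∃ p ∈ polyFunctions k (∀ i, Fin (d i) → V i), p x.1 ≠ 0 ∧
      ∀ y : FrameProduct k V d, p y.1 ≠ 0 → y ∈ O := by
  let := zariskiTopology k (∀ i, Fin (d i) → V i)
  obtain ⟨S, hS, rfl⟩ := isOpen_induced_iff.1 hO
  obtain ⟨_, ⟨p, hp, rfl⟩, hpx, hpS⟩ :=
    isTopologicalBasis_zariski.exists_subset_of_mem_open (show x.1 ∈ S from hx) hS
  exact ⟨p, hp, hpx, fun y hy => hpS hy⟩

theorem FrameProduct.isOpen_of_basic {d : ι → ℕ} {O : Set (FrameProduct k V d)}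
    (h : ∀ x ∈ O, ∃ p ∈ polyFunctions k (∀ i, Fin (d i) → V i), p x.1 ≠ 0 ∧
      ∀ y : FrameProduct k V d, p y.1 ≠ 0 → y ∈ O) : IsOpen O := by
  let := zariskiTopology k (∀ i, Fin (d i) → V i)
  refine isOpen_iff_forall_mem_open.2 fun x hx => ?_
  obtain ⟨p, hp, hpx, hpO⟩ := h x hx
  exact ⟨{y | p y.1 ≠ 0}, hpO, isOpen_induced_iff.2
    ⟨{z | p z ≠ 0}, isTopologicalBasis_zariski.isOpen ⟨p, hp, rfl⟩, rfl⟩, hpx⟩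

/-- The variety of families of frames is irreducible. -/
theorem FrameProduct.inter_nonempty [Infinite k] [Finite ι] {d : ι → ℕ}
    {O O' : Set (FrameProduct k V d)} (hO : IsOpen O) (hO' : IsOpen O') (h : O.Nonempty)
    (h' : O'.Nonempty) : (O ∩ O').Nonempty := by
  obtain ⟨x, hx⟩ := h
  obtain ⟨y, hy⟩ := h'
  obtain ⟨p, hp, hpx, hpO⟩ := FrameProduct.exists_basic_open hO hx
  obtain ⟨q, hq, hqy, hqO⟩ := FrameProduct.exists_basic_open hO' hy
  -- The factor `r` ensures that the common point found in the ambient vector space is again a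
  -- family of frames.
  obtain ⟨r, hr, hrx, hrO⟩ := exists_polyFunction_linearIndependent x.2
  obtain ⟨z, hz, hqz⟩ := exists_common_ne_zero (mul_mem hp hr) hq (mul_ne_zero hpx hrx) hqy
  exact ⟨⟨z, hrO z (right_ne_zero_of_mul hz)⟩, hpO _ (left_ne_zero_of_mul hz), hqO _ hqz⟩

theorem FrameProduct.span_surjective [∀ i, FiniteDimensional k (V i)] (d : ι → ℕ) :
    Function.Surjective (FrameProduct.span k V (d := d)) := by
  rintro ⟨U, hU⟩
  let b := fun i => Module.finBasisOfFinrankEq k (U i) (hU i)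
  refine ⟨⟨fun i s => b i s, fun i => (b i).linearIndependent.map' (U i).subtype
    (U i).ker_subtype⟩, Subtype.ext (funext fun i => ?_)⟩
  change Submodule.span k (Set.range ((U i).subtype ∘ b i)) = U i
  rw [Set.range_comp, Submodule.span_image, (b i).span_eq, Submodule.map_top, Submodule.range_subtype]

/-- A Zariski open property of families of frames depending only on the spans holds for a general
choice of subspaces as soon as it holds for some family of frames in each possible dimension. -/
theorem forGeneralSubspaces_of_frames [Infinite k] [Finite ι] [∀ i, FiniteDimensional k (V i)]
    {R : (∀ i, Submodule k (V i)) → Prop}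
    (hopen : ∀ (d : ι → ℕ) (x : FrameProduct k V d), R (x.span k V).1 →
      ∃ p ∈ polyFunctions k (∀ i, Fin (d i) → V i), p x.1 ≠ 0 ∧
        ∀ y : FrameProduct k V d, p y.1 ≠ 0 → R (y.span k V).1)
    (hex : ∀ d : ι → ℕ, Nonempty (FrameProduct k V d) →
      ∃ x : FrameProduct k V d, R (x.span k V).1) :
    ForGeneralSubspaces k R := by
  intro d
  have hO : IsOpen (FrameProduct.span k V ⁻¹' {U : GrassmannianProduct k V d | R U.1}) :=
    FrameProduct.isOpen_of_basic fun x hx => hopen d x hx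
  refine ⟨{U | R U.1}, isOpen_coinduced.2 hO, dense_iff_inter_open.2 fun O' hO' h' => ?_,
    fun U hU => hU⟩
  -- Density is checked upstairs: the preimages of both sets are open and nonempty, so they share a
  -- frame.
  obtain ⟨U, hU⟩ := h'
  obtain ⟨x, rfl⟩ := FrameProduct.span_surjective d U
  obtain ⟨y, hy⟩ := hex d ⟨x⟩
  obtain ⟨z, hz, hz'⟩ := FrameProduct.inter_nonempty (isOpen_coinduced.1 hO') hO ⟨x, hU⟩ ⟨y, hy⟩
  exact ⟨_, hz, hz'⟩

/-- In an affine family of linear maps over the variety of frames there is a member at which all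
derivatives map the kernel into the range. -/
theorem exists_frame_apply_mem_range [Infinite k] [Finite ι] {d : ι → ℕ}
    (hd : Nonempty (FrameProduct k V d)) {P Q : Type*} [AddCommGroup P] [Module k P]
    [AddCommGroup Q] [Module k Q] [FiniteDimensional k Q] (F₀ : P →ₗ[k] Q)
    (F : (∀ i, Fin (d i) → V i) →ₗ[k] P →ₗ[k] Q) :
    ∃ x : FrameProduct k V d, ∀ y a, (F₀ + F x.1) a = 0 →
      F y a ∈ LinearMap.range (F₀ + F x.1) := by
  let ρ : FrameProduct k V d → ℕ := fun x => Module.finrank k (LinearMap.range (F₀ + F x.1))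
  have hb : BddAbove (Set.range ρ) := ⟨Module.finrank k Q, by
    rintro _ ⟨x, rfl⟩
    exact Submodule.finrank_le _⟩
  obtain ⟨x, hx⟩ := Nat.sSup_mem (Set.range_nonempty ρ) hb
  -- The rank is maximal among frames only; `p` restricts the comparison to points that are frames.
  obtain ⟨p, hp, hpx, hpi⟩ := exists_polyFunction_linearIndependent x.2
  refine ⟨x, fun y a ha => apply_mem_range_of_rank_max F₀ F hp hpx (fun z hz => ?_) y ha⟩
  exact (le_csSup hb ⟨⟨z, hpi z hz⟩, rfl⟩ : ρ ⟨z, hpi z hz⟩ ≤ _).trans hx.ge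

end Frames

/-! ### From omnipresence to general subspaces. -/

section GeneralRank

variable {k : Type u} [Field k] {l : ℕ} {n : Fin l → ℕ} {V : Fin l → Type w}
  [∀ i, AddCommGroup (V i)] [∀ i, Module k (V i)]

theorem mem_powSubspace_span {d : Fin l → ℕ} (x : FrameProduct k V d) {b : ∀ i, Fin (n i) → V i} :
    b ∈ powSubspace n (x.span k V).1 ↔ ∃ c, comb k V n d x.1 c = b := by
  simp only [powSubspace, Submodule.mem_pi, Set.mem_univ, true_imp_iff, FrameProduct.span,
    Submodule.mem_span_range_iff_exists_fun]
  constructor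
  · intro h
    choose c hc using h
    exact ⟨c, funext fun i => funext fun j => hc i j⟩
  · rintro ⟨c, rfl⟩ i j
    exact ⟨c i j, rfl⟩

theorem powMkQ_eq_zero_iff {U : ∀ i, Submodule k (V i)} {b : ∀ i, Fin (n i) → V i} :
    powMkQ n U b = 0 ↔ b ∈ powSubspace n U := by
  simp [powMkQ, powSubspace, Submodule.mem_pi, funext_iff]

theorem powMkQ_surjective (U : ∀ i, Submodule k (V i)) : Function.Surjective (powMkQ n U) := by
  intro q
  choose b hb using fun i j => (U i).mkQ_surjective (q i j)
  exact ⟨b, funext fun i => funext fun j => hb i j⟩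

/-- A frame identifies the varying subspace with a fixed coefficient space, turning the restrictions
of `g` into a family linear in the frame. -/
theorem hasMaximalRank_domRestrict_iff {C : Type*} [AddCommGroup C] [Module k C]
    (g : (∀ i, Fin (n i) → V i) →ₗ[k] C) {d : Fin l → ℕ} (x : FrameProduct k V d) :
    HasMaximalRank (g.domRestrict (powSubspace n (x.span k V).1)) ↔
      HasMaximalRank (g ∘ₗ comb k V n d x.1) := by
  refine or_congr ?_ ?_
  · rw [injective_iff_map_eq_zero, injective_iff_map_eq_zero]
    constructor
    · intro h c hc
      have := h ⟨_, (mem_powSubspace_span x).2 ⟨c, rfl⟩⟩ hc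
      exact (injective_iff_map_eq_zero _).1 (comb_injective n x.2) c (congrArg Subtype.val this)
    · rintro h ⟨b, hb⟩ hgb
      obtain ⟨c, rfl⟩ := (mem_powSubspace_span x).1 hb
      refine Subtype.ext ?_
      simp [h c hgb]
  · constructor
    · intro h z
      obtain ⟨⟨b, hb⟩, rfl⟩ := h z
      obtain ⟨c, rfl⟩ := (mem_powSubspace_span x).1 hb
      exact ⟨c, rfl⟩
    · intro h z
      obtain ⟨c, rfl⟩ := h z
      exact ⟨⟨_, (mem_powSubspace_span x).2 ⟨c, rfl⟩⟩, rfl⟩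

/-- The projection has as kernel the range of the injective map `comb x`. Adjoining that map to `f`
instead of dividing by its range keeps the target fixed and preserves both injectivity and
surjectivity. -/
theorem hasMaximalRank_powMkQ_comp_iff {A : Type*} [AddCommGroup A] [Module k A]
    (f : A →ₗ[k] ∀ i, Fin (n i) → V i) {d : Fin l → ℕ} (x : FrameProduct k V d) :
    HasMaximalRank (powMkQ n (x.span k V).1 ∘ₗ f) ↔
      HasMaximalRank (f.coprod (comb k V n d x.1)) := by
  refine or_congr ?_ ?_
  · rw [injective_iff_map_eq_zero, injective_iff_map_eq_zero]
    constructor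
    · rintro h ⟨a, c⟩ hac
      rw [LinearMap.coprod_apply] at hac
      have ha : a = 0 := h a <| powMkQ_eq_zero_iff.2 <| (mem_powSubspace_span x).2
        ⟨-c, by rw [map_neg]; exact (eq_neg_of_add_eq_zero_left hac).symm⟩
      subst ha
      rw [map_zero, zero_add] at hac
      rw [(injective_iff_map_eq_zero _).1 (comb_injective n x.2) c hac]
      rfl
    · intro h a ha
      obtain ⟨c, hc⟩ := (mem_powSubspace_span x).1 (powMkQ_eq_zero_iff.1 ha)
      exact congrArg Prod.fst (h (a, -c) (by simp [hc]))
  · constructor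
    · intro h b
      obtain ⟨a, ha⟩ := h (powMkQ n _ b)
      rw [LinearMap.comp_apply, eq_comm, ← sub_eq_zero, ← map_sub, powMkQ_eq_zero_iff,
        mem_powSubspace_span] at ha
      obtain ⟨c, hc⟩ := ha
      exact ⟨(a, c), by simp [hc]⟩
    · intro h q
      obtain ⟨b, rfl⟩ := powMkQ_surjective _ q
      obtain ⟨⟨a, c⟩, rfl⟩ := h b
      refine ⟨a, ?_⟩
      rw [LinearMap.coprod_apply, map_add, powMkQ_eq_zero_iff.2 ((mem_powSubspace_span x).2 ⟨c, rfl⟩),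
        add_zero, LinearMap.comp_apply]

/-- If the restrictions of `g` to the subspaces `⨁ Vᵢ ⊗ W'ᵢ` have maximal rank, then so do its
restrictions to general subspaces `⨁ Uᵢ ⊗ Wᵢ`. -/
theorem forGeneralSubspaces_domRestrict [Infinite k] [∀ i, FiniteDimensional k (V i)] {C : Type*}
    [AddCommGroup C] [Module k C] [FiniteDimensional k C] (g : (∀ i, Fin (n i) → V i) →ₗ[k] C)
    (h : ∀ (d : Fin l → ℕ) (c : ∀ i, Fin (n i) → Fin (d i) → k),
      (∀ y, g (comb k V n d y c) = 0 → comb k V n d y c = 0) ∨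
        ∀ z, ∃ y, g (comb k V n d y c) = z) :
    ForGeneralSubspaces k fun U : ∀ i, Submodule k (V i) =>
      HasMaximalRank (g.domRestrict (powSubspace n U)) := by
  have key : ∀ (d : Fin l → ℕ) (x : FrameProduct k V d),
      HasMaximalRank (g.domRestrict (powSubspace n (x.span k V).1)) ↔
        HasMaximalRank (0 + (LinearMap.compRight k g ∘ₗ comb k V n d) x.1) := fun d x => by
    rw [hasMaximalRank_domRestrict_iff, zero_add]
    rfl
  refine forGeneralSubspaces_of_frames (fun d x hx => ?_) fun d hd => ?_
  · simp only [key] at hx ⊢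
    obtain ⟨p, hp, hpx, hpy⟩ := exists_polyFunction_hasMaximalRank _ _ hx
    exact ⟨p, hp, hpx, fun y hy => hpy _ hy⟩
  · obtain ⟨x, hx⟩ := exists_frame_apply_mem_range hd 0 (LinearMap.compRight k g ∘ₗ comb k V n d)
    refine ⟨x, (key d x).2 (or_iff_not_imp_left.2 fun hinj => ?_)⟩
    rw [injective_iff_map_eq_zero] at hinj
    push Not at hinj
    obtain ⟨c, hc, hc0⟩ := hinj
    -- Injectivity on the combinations with coefficients `c` fails at the frame `x` itself, since
    -- independence makes `comb x c` nonzero. In the other case every `z` is a derivative applied to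
    -- the kernel element `c`.
    obtain h1 | h2 := h d c
    · exact absurd ((injective_iff_map_eq_zero _).1 (comb_injective n x.2) c
        (h1 x.1 (by simpa using hc))) hc0
    · intro z
      obtain ⟨y, rfl⟩ := h2 z
      exact hx y c hc

/-- If the compositions of `f` with the projections to `⨁ Vᵢ ⊗ (Wᵢ / W'ᵢ)` have maximal rank, then
so do its compositions with the projections to `⨁ (Vᵢ / Uᵢ) ⊗ Wᵢ` for general `Uᵢ`. -/
theorem forGeneralSubspaces_powMkQ_comp [Infinite k] [∀ i, FiniteDimensional k (V i)] {A : Type*}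
    [AddCommGroup A] [Module k A] [FiniteDimensional k A] (f : A →ₗ[k] ∀ i, Fin (n i) → V i)
    (h : ∀ (d : Fin l → ℕ) (c : ∀ i, Fin (n i) → Fin (d i) → k),
      (∀ a y, f a = comb k V n d y c → a = 0) ∨ ∀ b, ∃ a y, f a + comb k V n d y c = b) :
    ForGeneralSubspaces k fun U : ∀ i, Submodule k (V i) => HasMaximalRank (powMkQ n U ∘ₗ f) := by
  let F₀ (d : Fin l → ℕ) : (A × ∀ i, Fin (n i) → Fin (d i) → k) →ₗ[k] ∀ i, Fin (n i) → V i :=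
    f ∘ₗ LinearMap.fst k _ _
  let F (d : Fin l → ℕ) : (∀ i, Fin (d i) → V i) →ₗ[k]
      (A × ∀ i, Fin (n i) → Fin (d i) → k) →ₗ[k] ∀ i, Fin (n i) → V i :=
    LinearMap.lcomp k _ (LinearMap.snd k _ _) ∘ₗ comb k V n d
  have hF : ∀ d x, F₀ d + F d x = f.coprod (comb k V n d x) := fun d x => rfl
  have key : ∀ (d : Fin l → ℕ) (x : FrameProduct k V d),
      HasMaximalRank (powMkQ n (x.span k V).1 ∘ₗ f) ↔ HasMaximalRank (F₀ d + F d x.1) :=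
    fun d x => by rw [hasMaximalRank_powMkQ_comp_iff, hF]
  refine forGeneralSubspaces_of_frames (fun d x hx => ?_) fun d hd => ?_
  · simp only [key] at hx ⊢
    obtain ⟨p, hp, hpx, hpy⟩ := exists_polyFunction_hasMaximalRank _ _ hx
    exact ⟨p, hp, hpx, fun y hy => hpy _ hy⟩
  · obtain ⟨x, hx⟩ := exists_frame_apply_mem_range hd (F₀ d) (F d)
    refine ⟨x, (key d x).2 (or_iff_not_imp_left.2 fun hinj => ?_)⟩
    rw [injective_iff_map_eq_zero] at hinj
    push Not at hinj
    obtain ⟨⟨a, c⟩, hc, hc0⟩ := hinj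
    have hac : f a + comb k V n d x.1 c = 0 := hc
    obtain h1 | h2 := h d c
    · have ha : a = 0 := h1 a (-x.1) (by
        rw [map_neg, LinearMap.neg_apply]
        exact eq_neg_of_add_eq_zero_left hac)
      subst ha
      rw [map_zero, zero_add] at hac
      rw [(injective_iff_map_eq_zero _).1 (comb_injective n x.2) c hac] at hc0
      exact absurd rfl hc0
    · refine LinearMap.range_eq_top.1 (eq_top_iff.2 fun b _ => ?_)
      obtain ⟨a', y, rfl⟩ := h2 b
      -- The first summand is the value at `(a', 0)`; the second is the derivative along `y` at the
      -- kernel element `(a, c)`.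
      refine add_mem ⟨(a', 0), ?_⟩ (hx y (a, c) hc)
      rw [hF]
      simp

end GeneralRank

/-! ### Factoring through kernels and images. -/

section Factorization

variable {R : Type*} [Ring R] {M N P : Type*} [AddCommGroup M] [Module R M] [AddCommGroup N]
  [Module R N] [AddCommGroup P] [Module R P]

theorem exists_comp_eq_of_surjective {g : M →ₗ[R] N} (hg : Function.Surjective g) {φ : M →ₗ[R] P}
    (h : ∀ m, g m = 0 → φ m = 0) : ∃ γ : N →ₗ[R] P, γ ∘ₗ g = φ := by
  refine ⟨(LinearMap.ker g).liftQ φ (fun m hm => h m (LinearMap.mem_ker.1 hm)) ∘ₗ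
    (g.quotKerEquivOfSurjective hg).symm.toLinearMap, LinearMap.ext fun m => ?_⟩
  have : (g.quotKerEquivOfSurjective hg).symm (g m) = Submodule.Quotient.mk m := by
    rw [LinearEquiv.symm_apply_eq]
    rfl
  exact congrArg ((LinearMap.ker g).liftQ φ fun m hm => h m (LinearMap.mem_ker.1 hm)) this

theorem exists_comp_eq_of_injective {f : M →ₗ[R] N} (hf : Function.Injective f) {φ : P →ₗ[R] N}
    (h : ∀ p, ∃ m, f m = φ p) : ∃ α : P →ₗ[R] M, f ∘ₗ α = φ := by
  refine ⟨(LinearEquiv.ofInjective f hf).symm.toLinearMap ∘ₗ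
    φ.codRestrict (LinearMap.range f) h, LinearMap.ext fun p => ?_⟩
  exact congrArg Subtype.val ((LinearEquiv.ofInjective f hf).apply_symm_apply ⟨φ p, h p⟩)

end Factorization

/-! ### Consequences of minimality and almost split sequences. -/

section AlmostSplit

variable {k : Type u} [Field k] {Λ : Type v} [Ring Λ] [Algebra k Λ]
  {A B C : Type w} [AddCommGroup A] [Module Λ A] [AddCommGroup B] [Module Λ B] [AddCommGroup C]
  [Module Λ C] {B' : Type*} [AddCommGroup B'] [Module Λ B']

/-- The restriction of a minimal right almost split morphism to a direct summand is injective or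
surjective. -/
theorem IsMinimalRightAlmostSplit.injective_or_surjective_comp [Module k C] [IsScalarTower k Λ C]
    [FiniteDimensional k C] {g : B →ₗ[Λ] C} (hg : IsMinimalRightAlmostSplit k g)
    {p : B' →ₗ[Λ] B} {q : B →ₗ[Λ] B'} (hqp : q ∘ₗ p = LinearMap.id) :
    Function.Injective (g ∘ₗ p) ∨ Function.Surjective (g ∘ₗ p) := by
  refine or_iff_not_imp_right.2 fun hs => ?_
  have : FiniteDimensional k (LinearMap.range (g ∘ₗ p)) :=
    Module.Finite.of_injective ((LinearMap.range (g ∘ₗ p)).subtype.restrictScalars k)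
      Subtype.val_injective
  -- A section of the inclusion of the image would make `g ∘ p` surjective.
  obtain ⟨t, ht⟩ := hg.1.2 (LinearMap.range (g ∘ₗ p)) (LinearMap.range (g ∘ₗ p)).subtype (by
    rintro ⟨s, h⟩
    refine hs fun c => ?_
    obtain ⟨b, hb⟩ := (s c).2
    exact ⟨b, hb.trans (LinearMap.congr_fun h c)⟩)
  have ht' : ∀ m, g (t m) = m := LinearMap.congr_fun ht
  have hqp' : ∀ b, q (p b) = b := LinearMap.congr_fun hqp
  have hθ := (hg.2 (t ∘ₗ (g ∘ₗ p).rangeRestrict ∘ₗ q + (LinearMap.id - p ∘ₗ q)) (by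
    ext b
    simp [ht'])).1
  refine (injective_iff_map_eq_zero _).2 fun b hb => ?_
  have h0 : (g ∘ₗ p).rangeRestrict b = 0 := Subtype.ext hb
  have hpb := (injective_iff_map_eq_zero _).1 hθ (p b) (by
    simp only [LinearMap.add_apply, LinearMap.comp_apply, LinearMap.sub_apply, LinearMap.id_apply,
      hqp', h0, map_zero, sub_self, add_zero])
  simpa [hqp'] using congrArg q hpb

/-- The corestriction of a minimal left almost split morphism to a direct summand is injective or
surjective. -/
theorem IsMinimalLeftAlmostSplit.injective_or_surjective_comp [Module k A] [IsScalarTower k Λ A]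
    [FiniteDimensional k A] {f : A →ₗ[Λ] B} (hf : IsMinimalLeftAlmostSplit k f)
    {p : B →ₗ[Λ] B'} {s : B' →ₗ[Λ] B} (hps : p ∘ₗ s = LinearMap.id) :
    Function.Injective (p ∘ₗ f) ∨ Function.Surjective (p ∘ₗ f) := by
  refine or_iff_not_imp_left.2 fun hi => ?_
  obtain ⟨t, ht⟩ := hf.1.2 (A ⧸ LinearMap.ker (p ∘ₗ f)) (LinearMap.ker (p ∘ₗ f)).mkQ (by
    rintro ⟨r, h⟩
    refine hi ((injective_iff_map_eq_zero _).2 fun a ha => ?_)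
    have : (LinearMap.ker (p ∘ₗ f)).mkQ a = 0 := (Submodule.Quotient.mk_eq_zero _).2 ha
    rw [← LinearMap.id_apply (R := Λ) a, ← h, LinearMap.comp_apply, this, map_zero])
  have ht' : ∀ a, t (f a) = (LinearMap.ker (p ∘ₗ f)).mkQ a := LinearMap.congr_fun ht
  have hps' : ∀ b, p (s b) = b := LinearMap.congr_fun hps
  let f' := (LinearMap.ker (p ∘ₗ f)).liftQ (p ∘ₗ f) le_rfl
  -- This endomorphism fixes `f` because `f' t f = p f`. Composing it with `p` leaves `f' t`, whose
  -- image is that of `p ∘ f`.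
  have hθ := (hf.2 (s ∘ₗ f' ∘ₗ t + (LinearMap.id - s ∘ₗ p)) (by
    ext a
    simp [ht', f'])).2
  intro b
  obtain ⟨b₀, hb₀⟩ := hθ (s b)
  obtain ⟨a, ha⟩ := (LinearMap.ker (p ∘ₗ f)).mkQ_surjective (t b₀)
  refine ⟨a, ?_⟩
  have h := congrArg p hb₀
  simp only [LinearMap.add_apply, LinearMap.sub_apply, LinearMap.comp_apply, LinearMap.id_apply,
    map_add, map_sub, hps', sub_self, add_zero, ← ha] at h
  exact h

variable [Module k B] [IsScalarTower k Λ B] [FiniteDimensional k B]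

/-- An endomorphism `θ` with `g θ = g` induces `α` on `A`. If `α` is injective, so is `θ`, and
finite dimension finishes. Otherwise `α` is not a split monomorphism, so `α = β f`; then `θ - f β`
kills the image of `f` and factors as `γ g`, and `γ` splits `g`, a contradiction. -/
theorem IsAlmostSplitSequence.isMinimalRightAlmostSplit [Module k A] [IsScalarTower k Λ A] [FiniteDimensional k A]
    {f : A →ₗ[Λ] B} {g : B →ₗ[Λ] C}
    (h : IsAlmostSplitSequence k f g) : IsMinimalRightAlmostSplit k g := by
  obtain ⟨hf, hfg, hg, hl, hr⟩ := h
  refine ⟨hr, fun θ hθ => ?_⟩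
  have hθ' : ∀ b, g (θ b) = g b := LinearMap.congr_fun hθ
  obtain ⟨α, hα⟩ := exists_comp_eq_of_injective hf (φ := θ ∘ₗ f) fun a =>
    (hfg _).1 (by simp [hθ', hfg.apply_apply_eq_zero])
  have hα' : ∀ a, f (α a) = θ (f a) := LinearMap.congr_fun hα
  by_cases hi : Function.Injective α
  · have hθi : Function.Injective θ := by
      refine (injective_iff_map_eq_zero _).2 fun b hb => ?_
      obtain ⟨a, rfl⟩ := (hfg b).1 (by rw [← hθ', hb, map_zero])
      rw [← hα', ← map_zero f] at hb
      rw [(injective_iff_map_eq_zero _).1 hi a (hf hb), map_zero]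
    exact ⟨hθi, (LinearMap.injective_iff_surjective (f := θ.restrictScalars k)).1 hθi⟩
  · obtain ⟨β, hβ⟩ := hl.2 A α (by
      rintro ⟨r, hrα⟩
      exact hi (Function.LeftInverse.injective (g := r) (LinearMap.congr_fun hrα)))
    have hβ' : ∀ a, β (f a) = α a := LinearMap.congr_fun hβ
    obtain ⟨γ, hγ⟩ := exists_comp_eq_of_surjective hg (φ := θ - f ∘ₗ β) fun b hb => by
      obtain ⟨a, rfl⟩ := (hfg b).1 hb
      simp [hβ', hα']
    refine absurd ⟨γ, LinearMap.ext fun c => ?_⟩ hr.1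
    obtain ⟨b, rfl⟩ := hg c
    have := LinearMap.congr_fun hγ b
    simp only [LinearMap.comp_apply, LinearMap.sub_apply] at this
    simp [this, hθ', hfg.apply_apply_eq_zero]

/-- Dual argument: `θ` induces `γ` on `C`. If `γ` is not onto, then `γ = g β`, and `θ - β g` lands
in the image of `f` and yields a retraction of `f`. -/
theorem IsAlmostSplitSequence.isMinimalLeftAlmostSplit [Module k C] [IsScalarTower k Λ C] [FiniteDimensional k C]
    {f : A →ₗ[Λ] B} {g : B →ₗ[Λ] C}
    (h : IsAlmostSplitSequence k f g) : IsMinimalLeftAlmostSplit k f := by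
  obtain ⟨hf, hfg, hg, hl, hr⟩ := h
  refine ⟨hl, fun θ hθ => ?_⟩
  have hθ' : ∀ a, θ (f a) = f a := LinearMap.congr_fun hθ
  obtain ⟨γ, hγ⟩ := exists_comp_eq_of_surjective hg (φ := g ∘ₗ θ) fun b hb => by
    obtain ⟨a, rfl⟩ := (hfg b).1 hb
    simp [hθ', hfg.apply_apply_eq_zero]
  have hγ' : ∀ b, γ (g b) = g (θ b) := LinearMap.congr_fun hγ
  by_cases hs : Function.Surjective γ
  · have hθs : Function.Surjective θ := by
      intro b
      obtain ⟨c, hc⟩ := hs (g b)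
      obtain ⟨b', rfl⟩ := hg c
      obtain ⟨a, ha⟩ := (hfg (b - θ b')).1 (by rw [map_sub, ← hγ', hc, sub_self])
      exact ⟨b' + f a, by rw [map_add, hθ', ha, add_sub_cancel]⟩
    exact ⟨(LinearMap.injective_iff_surjective (f := θ.restrictScalars k)).2 hθs, hθs⟩
  · obtain ⟨β, hβ⟩ := hr.2 C γ (by
      rintro ⟨s, hγs⟩
      exact hs (Function.RightInverse.surjective (g := s) (LinearMap.congr_fun hγs)))
    have hβ' : ∀ c, g (β c) = γ c := LinearMap.congr_fun hβ
    obtain ⟨α, hα⟩ := exists_comp_eq_of_injective hf (φ := θ - β ∘ₗ g) fun b =>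
      (hfg _).1 (by simp [hβ', hγ'])
    refine absurd ⟨α, LinearMap.ext fun a => hf ?_⟩ hl.1
    have := LinearMap.congr_fun hα (f a)
    simpa [hθ', hfg.apply_apply_eq_zero] using this

theorem IsAlmostSplitSequence.finrank_eq [Module k A] [IsScalarTower k Λ A]
    [Module k C] [IsScalarTower k Λ C]
    {f : A →ₗ[Λ] B} {g : B →ₗ[Λ] C}
    (h : IsAlmostSplitSequence k f g) :
    Module.finrank k B = Module.finrank k A + Module.finrank k C := by
  obtain ⟨hf, hfg, hg, -⟩ := h
  have hker : LinearMap.ker (g.restrictScalars k) = LinearMap.range (f.restrictScalars k) :=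
    Submodule.ext hfg
  have h1 := (g.restrictScalars k).finrank_range_add_finrank_ker
  rw [hker, LinearMap.finrank_range_of_inj (f := f.restrictScalars k) hf,
    LinearMap.range_eq_top.2 (show Function.Surjective (g.restrictScalars k) from hg),
    finrank_top] at h1
  omega

end AlmostSplit

/-! ### Tensor products with multiplicity spaces. -/

section Tensor

variable {k : Type u} [Field k]

section Exact

variable {ι : Type*} {V W : ι → Type*}
  [∀ i, AddCommGroup (V i)] [∀ i, Module k (V i)] [∀ i, AddCommGroup (W i)] [∀ i, Module k (W i)]

/-- Right exactness of the tensor product, in each component. -/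
theorem piMap_lTensor_mkQ_eq_zero_iff (W' : ∀ i, Submodule k (W i)) {τ : ∀ i, V i ⊗[k] W i} :
    LinearMap.piMap (fun i => (W' i).mkQ.lTensor (V i)) τ = 0 ↔
      ∃ σ, LinearMap.piMap (fun i => (W' i).subtype.lTensor (V i)) σ = τ := by
  have hex := fun i => lTensor_exact (V i) (LinearMap.exact_subtype_mkQ (W' i)) (W' i).mkQ_surjective
  constructor
  · intro h
    choose σ hσ using fun i => (hex i (τ i)).1 (congrFun h i)
    exact ⟨σ, funext hσ⟩
  · rintro ⟨σ, rfl⟩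
    exact funext fun i => (hex i _).2 ⟨σ i, rfl⟩

/-- A tensor in `X ⊗ Y` lies in `X ⊗ Y'` for some subspace `Y'` with `dim Y' ≤ dim X`. -/
theorem exists_finrank_le_mem_range_lTensor {X Y : Type*} [AddCommGroup X] [Module k X]
    [FiniteDimensional k X] [AddCommGroup Y] [Module k Y] (τ : X ⊗[k] Y) :
    ∃ Y' : Submodule k Y, Module.finrank k Y' ≤ Module.finrank k X ∧
      ∃ σ, Y'.subtype.lTensor X σ = τ := by
  let b := Module.finBasis k X
  -- Writing `τ = ∑ bₛ ⊗ yₛ` along a basis of `X`, the subspace `Y'` is the span of the `yₛ`.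
  let y := TensorProduct.equivFinsuppOfBasisLeft (N := Y) b τ
  refine ⟨Submodule.span k (Set.range y), ?_, ∑ s, b s ⊗ₜ ⟨y s, Submodule.subset_span ⟨s, rfl⟩⟩, ?_⟩
  · exact (finrank_range_le_card (R := k) y).trans (by simp)
  · rw [← (TensorProduct.equivFinsuppOfBasisLeft (N := Y) b).symm_apply_apply τ,
      TensorProduct.equivFinsuppOfBasisLeft_symm_apply, Finsupp.sum_fintype _ _ (by simp)]
    simp [y]

end Exact

variable (k) {Λ : Type v} [Ring Λ] [Algebra k Λ]

theorem tensorCoord_tmul {X : Type w} [AddCommGroup X] [Module k X] [Module Λ X]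
    [IsScalarTower k Λ X] {m : ℕ} (j : Fin m) (x : X) (w : MultSpace k m) :
    tensorCoord k X j (Λ := Λ) (x ⊗ₜ w) = w j • x := rfl

/-- The isomorphism `X ⊗ W ≃ X ^ m` for a space `W` with a basis `e₁, …, eₘ`. -/
noncomputable def tensorPowEquiv (X : Type w) [AddCommGroup X] [Module k X] [Module Λ X]
    [IsScalarTower k Λ X] (m : ℕ) : X ⊗[k] MultSpace k m ≃ₗ[Λ] (Fin m → X) :=
  LinearEquiv.ofLinearMap (LinearMap.pi fun j => tensorCoord k X j)
    (∑ j, tensorIncl k X j ∘ₗ LinearMap.proj j)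
    (by
      refine LinearMap.pi_ext' fun j => LinearMap.ext fun x => funext fun j' => ?_
      simp [tensorCoord, tensorIncl, basisVec, Pi.single_apply])
    (by
      refine TensorProduct.AlgebraTensorModule.ext fun x w => ?_
      rw [LinearMap.comp_apply, LinearMap.sum_apply]
      have hw : ∑ j, w j • basisVec k j = w := by
        ext j
        simp [basisVec, Pi.single_apply]
      calc ∑ j, tensorCoord k X j (x ⊗ₜ w) ⊗ₜ[k] basisVec k j = x ⊗ₜ ∑ j, w j • basisVec k j := by
            simp only [tensorCoord_tmul, TensorProduct.smul_tmul, ← TensorProduct.tmul_sum]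
        _ = x ⊗ₜ w := by rw [hw])

end Tensor

/-! ### Omnipresence of `T` and `S`, and its form in coordinates. -/

section Coordinates

variable (k : Type u) [Field k] {Λ : Type v} [Ring Λ] [Algebra k Λ] {l : ℕ} (n : Fin l → ℕ)
  (V : Fin l → Type w) [∀ i, AddCommGroup (V i)] [∀ i, Module k (V i)] [∀ i, Module Λ (V i)]
  [∀ i, IsScalarTower k Λ (V i)]
  {A C : Type w} [AddCommGroup A] [Module Λ A] [AddCommGroup C] [Module Λ C]

/-- The isomorphism `⨁ Vᵢ ⊗ Wᵢ ≃ ⨁ Vᵢ ^ nᵢ`. -/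
noncomputable def tensorPiEquiv :
    (∀ i, V i ⊗[k] MultSpace k (n i)) ≃ₗ[Λ] ∀ i, Fin (n i) → V i :=
  LinearEquiv.piCongrRight fun i => tensorPowEquiv k (V i) (n i)

variable {n V}

/-- Identifies `T` with `g` up to an isomorphism, so that properties pass between them. -/
theorem mapT_eq (g : (∀ i, Fin (n i) → V i) →ₗ[Λ] C) :
    mapT k g = g ∘ₗ (tensorPiEquiv k n V).toLinearMap := by
  refine LinearMap.ext fun τ => ?_
  have hb : ∀ b, g b = ∑ i, ∑ j, compFrom g i j (b i j) := fun b => by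
    simp only [compFrom, LinearMap.comp_apply, ← map_sum]
    simp only [LinearMap.coe_single, Finset.univ_sum_single]
  rw [LinearMap.comp_apply, hb]
  simp only [mapT, LinearMap.sum_apply, LinearMap.comp_apply]
  rfl

theorem mapS_eq (f : A →ₗ[Λ] ∀ i, Fin (n i) → V i) :
    mapS k f = (tensorPiEquiv k n V).symm.toLinearMap ∘ₗ f := by
  refine LinearMap.ext fun a => funext fun i => ?_
  change (∑ j, tensorIncl k (V i) j ∘ₗ compInto f i j) a =
    (∑ j, tensorIncl k (V i) j ∘ₗ LinearMap.proj j) (f a i)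
  simp only [LinearMap.sum_apply]
  rfl

/-- A minimal right almost split morphism has the right omnipresent maximal rank property. -/
theorem IsMinimalRightAlmostSplit.rightOmnipresentFrom [Module k C] [IsScalarTower k Λ C]
    [FiniteDimensional k C] {g : (∀ i, Fin (n i) → V i) →ₗ[Λ] C}
    (hg : IsMinimalRightAlmostSplit k g) :
    RightOmnipresentFrom ((mapT k g).restrictScalars k) := by
  intro W'
  choose r hr using fun i =>
    (W' i).subtype.exists_leftInverse_of_injective (W' i).ker_subtype
  let e := tensorPiEquiv k n V (Λ := Λ)
  let p : (∀ i, V i ⊗[k] W' i) →ₗ[Λ] ∀ i, V i ⊗[k] MultSpace k (n i) :=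
    LinearMap.piMap fun i => TensorProduct.AlgebraTensorModule.lTensor Λ (V i) (W' i).subtype
  let q : (∀ i, V i ⊗[k] MultSpace k (n i)) →ₗ[Λ] ∀ i, V i ⊗[k] W' i :=
    LinearMap.piMap fun i => TensorProduct.AlgebraTensorModule.lTensor Λ (V i) (r i)
  have hqp : ∀ σ, q (p σ) = σ := fun σ => funext fun i => by
    change (r i).lTensor (V i) ((W' i).subtype.lTensor (V i) (σ i)) = σ i
    rw [← LinearMap.lTensor_comp_apply, hr, LinearMap.lTensor_id_apply]
  have h := hg.injective_or_surjective_comp (p := e.toLinearMap ∘ₗ p) (q := q ∘ₗ e.symm.toLinearMap)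
    (LinearMap.ext fun σ => by simp [hqp])
  rw [← LinearMap.comp_assoc, ← mapT_eq] at h
  exact h

/-- A minimal left almost split morphism has the right omnipresent maximal rank property. -/
theorem IsMinimalLeftAlmostSplit.rightOmnipresentInto [Module k A] [IsScalarTower k Λ A]
    [FiniteDimensional k A] {f : A →ₗ[Λ] ∀ i, Fin (n i) → V i}
    (hf : IsMinimalLeftAlmostSplit k f) :
    RightOmnipresentInto ((mapS k f).restrictScalars k) := by
  intro W'
  choose r hr using fun i =>
    (W' i).mkQ.exists_rightInverse_of_surjective (W' i).range_mkQ
  let e := tensorPiEquiv k n V (Λ := Λ)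
  let p : (∀ i, V i ⊗[k] MultSpace k (n i)) →ₗ[Λ] ∀ i, V i ⊗[k] (MultSpace k (n i) ⧸ W' i) :=
    LinearMap.piMap fun i => TensorProduct.AlgebraTensorModule.lTensor Λ (V i) (W' i).mkQ
  let s : (∀ i, V i ⊗[k] (MultSpace k (n i) ⧸ W' i)) →ₗ[Λ] ∀ i, V i ⊗[k] MultSpace k (n i) :=
    LinearMap.piMap fun i => TensorProduct.AlgebraTensorModule.lTensor Λ (V i) (r i)
  have hps : ∀ σ, p (s σ) = σ := fun σ => funext fun i => by
    change (W' i).mkQ.lTensor (V i) ((r i).lTensor (V i) (σ i)) = σ i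
    rw [← LinearMap.lTensor_comp_apply, hr, LinearMap.lTensor_id_apply]
  have h := hf.injective_or_surjective_comp (p := p ∘ₗ e.symm.toLinearMap) (s := e.toLinearMap ∘ₗ s)
    (LinearMap.ext fun σ => by simp [hps])
  rw [LinearMap.comp_assoc, ← mapS_eq] at h
  exact h

variable {k}

/-- The linear combinations with coefficients `c` of arbitrary vectors form the subspace
`⨁ Vᵢ ⊗ W'ᵢ`, where `W'ᵢ` is the range of the matrix `cᵢ`. -/
theorem exists_comb_eq_iff {d : Fin l → ℕ} (c : ∀ i, Fin (n i) → Fin (d i) → k)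
    {τ : ∀ i, V i ⊗[k] MultSpace k (n i)} :
    (∃ y, comb k V n d y c = tensorPiEquiv k n V (Λ := Λ) τ) ↔
      ∃ σ, LinearMap.piMap (fun i => (LinearMap.range
        (Matrix.mulVecLin (Matrix.of (c i)))).subtype.lTensor (V i)) σ = τ := by
  let γ := fun i => Matrix.mulVecLin (Matrix.of (c i))
  have hcomb : ∀ ρ : ∀ i, V i ⊗[k] MultSpace k (d i),
      comb k V n d (tensorPiEquiv k d V (Λ := Λ) ρ) c =
        tensorPiEquiv k n V (Λ := Λ) (fun i => (γ i).lTensor (V i) (ρ i)) := by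
    intro ρ
    ext i j
    rw [comb_apply]
    change ∑ s, c i j s • tensorCoord k (V i) s (Λ := Λ) (ρ i) =
      tensorCoord k (V i) j (Λ := Λ) ((γ i).lTensor (V i) (ρ i))
    induction ρ i using TensorProduct.induction_on with
    | zero => simp
    | add a b ha hb => simp only [map_add, smul_add, Finset.sum_add_distrib, ha, hb]
    | tmul v w =>
      simp only [LinearMap.lTensor_tmul, tensorCoord_tmul, γ, Matrix.mulVecLin_apply,
        Matrix.mulVec, dotProduct, Matrix.of_apply, Finset.sum_smul, mul_smul]
  -- The corestriction of `γᵢ` to its range stays surjective after tensoring, so every element of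
  -- `Vᵢ ⊗ W'ᵢ` comes from some family of vectors.
  have hγ : ∀ i, γ i = (LinearMap.range (γ i)).subtype ∘ₗ (γ i).rangeRestrict := fun i => rfl
  constructor
  · rintro ⟨y, hy⟩
    obtain ⟨ρ, rfl⟩ := (tensorPiEquiv k d V (Λ := Λ)).surjective y
    rw [hcomb] at hy
    refine ⟨fun i => (γ i).rangeRestrict.lTensor (V i) (ρ i), ?_⟩
    rw [← (tensorPiEquiv k n V (Λ := Λ)).injective hy]
    ext i
    exact (LinearMap.lTensor_comp_apply _ _ _ _).symm
  · rintro ⟨σ, rfl⟩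
    choose ρ hρ using fun i =>
      LinearMap.lTensor_surjective (V i) (γ i).surjective_rangeRestrict (σ i)
    refine ⟨tensorPiEquiv k d V (Λ := Λ) ρ, ?_⟩
    rw [hcomb]
    congr 1
    ext i
    rw [hγ i, LinearMap.lTensor_comp_apply, hρ]
    rfl

/-- Omnipresence applied with `W'ᵢ` the range of the matrix `cᵢ`: the form needed for a kernel
element `c` of the family over frames. -/
theorem RightOmnipresentFrom.comb_injective_or_surjective [Module k C] [IsScalarTower k Λ C]
    {g : (∀ i, Fin (n i) → V i) →ₗ[Λ] C}
    (h : RightOmnipresentFrom ((mapT k g).restrictScalars k)) (d : Fin l → ℕ)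
    (c : ∀ i, Fin (n i) → Fin (d i) → k) :
    (∀ y, g (comb k V n d y c) = 0 → comb k V n d y c = 0) ∨
      ∀ z, ∃ y, g (comb k V n d y c) = z := by
  let e := tensorPiEquiv k n V (Λ := Λ)
  rw [mapT_eq] at h
  refine (h fun i => LinearMap.range (Matrix.mulVecLin (Matrix.of (c i)))).imp
    (fun hi y hy => ?_) fun hs z => ?_
  · obtain ⟨σ, hσ⟩ := (exists_comb_eq_iff (Λ := Λ) c (τ := e.symm (comb k V n d y c))).1
      ⟨y, (e.apply_symm_apply _).symm⟩
    have h0 := (injective_iff_map_eq_zero _).1 hi σ (by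
      rw [LinearMap.comp_apply, hσ]
      change g (e (e.symm _)) = 0
      rwa [e.apply_symm_apply])
    rw [h0, map_zero, eq_comm, LinearEquiv.map_eq_zero_iff] at hσ
    exact hσ
  · obtain ⟨σ, rfl⟩ := hs z
    obtain ⟨y, hy⟩ := (exists_comb_eq_iff (Λ := Λ) c).2 ⟨σ, rfl⟩
    exact ⟨y, congrArg g hy⟩

theorem RightOmnipresentInto.comb_injective_or_surjective [Module k A] [IsScalarTower k Λ A]
    {f : A →ₗ[Λ] ∀ i, Fin (n i) → V i}
    (h : RightOmnipresentInto ((mapS k f).restrictScalars k)) (d : Fin l → ℕ)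
    (c : ∀ i, Fin (n i) → Fin (d i) → k) :
    (∀ a y, f a = comb k V n d y c → a = 0) ∨ ∀ b, ∃ a y, f a + comb k V n d y c = b := by
  let e := tensorPiEquiv k n V (Λ := Λ)
  rw [mapS_eq] at h
  refine (h fun i => LinearMap.range (Matrix.mulVecLin (Matrix.of (c i)))).imp
    (fun hi a y hay => ?_) fun hs b => ?_
  · refine (injective_iff_map_eq_zero _).1 hi a ((piMap_lTensor_mkQ_eq_zero_iff _).2
      ((exists_comb_eq_iff (Λ := Λ) c).1 ⟨y, ?_⟩))
    exact hay.symm.trans (e.apply_symm_apply _).symm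
  · obtain ⟨a, ha⟩ := hs (LinearMap.piMap (fun i => Submodule.mkQ _ |>.lTensor (V i)) (e.symm b))
    rw [LinearMap.comp_apply, eq_comm, ← sub_eq_zero, ← map_sub, piMap_lTensor_mkQ_eq_zero_iff,
      ← exists_comb_eq_iff (Λ := Λ)] at ha
    obtain ⟨y, hy⟩ := ha
    refine ⟨a, y, ?_⟩
    rw [hy]
    change f a + e (e.symm b - e.symm (f a)) = b
    rw [map_sub, e.apply_symm_apply, e.apply_symm_apply, add_sub_cancel]

/-! ### Dimension bounds. -/

section Dimension

variable [∀ i, FiniteDimensional k (V i)]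

theorem finrank_pi_tensor_le {X : Fin l → Type*} [∀ i, AddCommGroup (X i)] [∀ i, Module k (X i)]
    [∀ i, FiniteDimensional k (X i)]
    (h : ∀ i, Module.finrank k (X i) ≤ Module.finrank k (V i)) :
    Module.finrank k (∀ i, V i ⊗[k] X i) ≤ ∑ i, Module.finrank k (V i) ^ 2 := by
  rw [Module.finrank_pi_fintype]
  refine Finset.sum_le_sum fun i _ => ?_
  rw [Module.finrank_tensorProduct, sq]
  exact Nat.mul_le_mul_left _ (h i)

/-- If `dim C` were at least the sum, each element of the kernel of `g` would lie in a piece `⨁ Vᵢ ⊗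
W'ᵢ` of dimension at most `dim C`. Maximal rank makes `g` injective on that piece, even in the
surjective case, where the dimensions agree. So `g` would be an isomorphism, hence split. -/
theorem finrank_lt_of_rightOmnipresentFrom [Module k C] [IsScalarTower k Λ C]
    [FiniteDimensional k C] {g : (∀ i, Fin (n i) → V i) →ₗ[Λ] C}
    (h : RightOmnipresentFrom ((mapT k g).restrictScalars k)) (hg : ¬ IsSplitEpi g)
    (hs : Function.Surjective g) :
    Module.finrank k C < ∑ i, Module.finrank k (V i) ^ 2 := by
  by_contra! hle
  let e := tensorPiEquiv k n V (Λ := Λ)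
  rw [mapT_eq] at h
  have hi : Function.Injective g := by
    refine (injective_iff_map_eq_zero _).2 fun b hb => ?_
    choose W' hW' σ hσ using fun i => exists_finrank_le_mem_range_lTensor (e.symm b i)
    have hσ' : LinearMap.piMap (fun i => (W' i).subtype.lTensor (V i)) σ = e.symm b := funext hσ
    have hinj := (h W').elim id fun hsurj => by
      refine (LinearMap.injective_iff_surjective_of_finrank_eq_finrank ?_).2 hsurj
      exact le_antisymm ((finrank_pi_tensor_le hW').trans hle)
        (LinearMap.finrank_le_finrank_of_surjective hsurj)
    have h0 := (injective_iff_map_eq_zero _).1 hinj σ (by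
      rw [LinearMap.comp_apply, hσ']
      change g (e (e.symm b)) = 0
      rwa [e.apply_symm_apply])
    rw [h0, map_zero, eq_comm, LinearEquiv.map_eq_zero_iff] at hσ'
    exact hσ'
  exact hg ⟨(LinearEquiv.ofBijective g ⟨hi, hs⟩).symm.toLinearMap, LinearMap.ext fun c =>
    (LinearEquiv.ofBijective g ⟨hi, hs⟩).apply_symm_apply c⟩

/-- If `dim A` were at least the sum, a nonzero functional `κ` vanishing on the image of `f` would
factor through quotients `Wᵢ / W'ᵢ` of dimension at most `dim Vᵢ`. Maximal rank makes `A` surject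
onto the resulting small quotient of `B`, which forces `κ = 0`. So `f` would be bijective, hence
split. -/
theorem finrank_lt_of_rightOmnipresentInto [Module k A] [IsScalarTower k Λ A]
    [FiniteDimensional k A] {f : A →ₗ[Λ] ∀ i, Fin (n i) → V i}
    (h : RightOmnipresentInto ((mapS k f).restrictScalars k)) (hf : ¬ IsSplitMono f)
    (hi : Function.Injective f) :
    Module.finrank k A < ∑ i, Module.finrank k (V i) ^ 2 := by
  by_contra! hle
  let e := tensorPiEquiv k n V (Λ := Λ)
  rw [mapS_eq] at h
  have hs : Function.Surjective f := by
    by_contra hs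
    obtain ⟨κ, hκ, hfκ⟩ := (LinearMap.range (f.restrictScalars k)).exists_le_ker_of_lt_top
      (lt_top_iff_ne_top.2 fun htop => hs ((LinearMap.range_eq_top (f := f.restrictScalars k)).1 htop))
    let κ' : (∀ i, V i ⊗[k] MultSpace k (n i)) →ₗ[k] k := κ ∘ₗ (e.restrictScalars k).toLinearMap
    -- On the `i`-th summand `κ'` is a bilinear form, read here as a map from `Wᵢ` to the dual of
    -- `Vᵢ`; its kernel therefore has codimension at most `dim Vᵢ`.
    let ψ := fun i => ((TensorProduct.mk k (V i) (MultSpace k (n i))).compr₂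
      (κ' ∘ₗ LinearMap.single k (fun i => V i ⊗[k] MultSpace k (n i)) i)).flip
    have hdim : ∀ i, Module.finrank k (MultSpace k (n i) ⧸ LinearMap.ker (ψ i)) ≤
        Module.finrank k (V i) := fun i => by
      rw [(ψ i).quotKerEquivRange.finrank_eq, ← Subspace.dual_finrank_eq]
      exact Submodule.finrank_le _
    have hvanish : κ' ∘ₗ LinearMap.piMap
        (fun i => (LinearMap.ker (ψ i)).subtype.lTensor (V i)) = 0 := by
      refine LinearMap.pi_ext' fun i => TensorProduct.ext' fun v w => ?_
      have hw : ψ i w v = 0 := by rw [LinearMap.mem_ker.1 w.2, LinearMap.zero_apply]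
      have hsingle : LinearMap.piMap (fun i => (LinearMap.ker (ψ i)).subtype.lTensor (V i))
          (Pi.single i (v ⊗ₜ w)) = Pi.single i (v ⊗ₜ[k] (w : MultSpace k (n i))) := by
        ext1 i'
        change (LinearMap.ker (ψ i')).subtype.lTensor (V i')
          ((Pi.single i (v ⊗ₜ w) : ∀ i, V i ⊗[k] LinearMap.ker (ψ i)) i') = _
        obtain rfl | hne := eq_or_ne i' i
        · simp
        · simp [hne]
      simp only [LinearMap.comp_apply, LinearMap.coe_single, LinearMap.zero_apply]
      rw [hsingle]
      exact hw
    have hsurj := (h fun i => LinearMap.ker (ψ i)).elim (fun hinj => by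
      refine (LinearMap.injective_iff_surjective_of_finrank_eq_finrank ?_).1 hinj
      exact le_antisymm (LinearMap.finrank_le_finrank_of_injective hinj)
        ((finrank_pi_tensor_le hdim).trans hle)) id
    -- Surjectivity writes `b` as `f a` plus an element of `⨁ Vᵢ ⊗ ker ψᵢ`, and `κ` kills both.
    refine hκ (LinearMap.ext fun b => ?_)
    obtain ⟨a, ha⟩ := hsurj (LinearMap.piMap (fun i => Submodule.mkQ _ |>.lTensor (V i)) (e.symm b))
    rw [LinearMap.comp_apply, eq_comm, ← sub_eq_zero, ← map_sub,
      piMap_lTensor_mkQ_eq_zero_iff] at ha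
    obtain ⟨σ, hσ⟩ := ha
    have h0 : κ' (e.symm b - e.symm (f a)) = 0 :=
      (congrArg κ' hσ).symm.trans (LinearMap.congr_fun hvanish σ)
    have h1 : κ (f a) = 0 := hfκ ⟨a, rfl⟩
    change κ (e (e.symm b - e.symm (f a))) = 0 at h0
    rw [map_sub, e.apply_symm_apply, e.apply_symm_apply, map_sub, h1, sub_zero] at h0
    rw [h0, LinearMap.zero_apply]
  exact hf ⟨(LinearEquiv.ofBijective f ⟨hi, hs⟩).symm.toLinearMap, LinearMap.ext fun a =>
    (LinearEquiv.ofBijective f ⟨hi, hs⟩).symm_apply_apply a⟩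

end Dimension

end Coordinates

end AlmostSplitRank

/-! ### Assembly of the seven statements. -/

theorem proposition3p1 (k : Type u) [Field k] [IsAlgClosed k] (Λ : Type v) [Ring Λ] [Algebra k Λ]
    (l : ℕ) (n : Fin l → ℕ)
    (V : Fin l → Type w) [∀ i, AddCommGroup (V i)] [∀ i, Module k (V i)] [∀ i, Module Λ (V i)]
    [∀ i, IsScalarTower k Λ (V i)] [∀ i, FiniteDimensional k (V i)]
    (hV : ∀ i, IsIndecomposable Λ (V i))
    (hne : ∀ i j, i ≠ j → IsEmpty (V i ≃ₗ[Λ] V j))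
    (A : Type w) [AddCommGroup A] [Module k A] [Module Λ A] [IsScalarTower k Λ A]
    [FiniteDimensional k A]
    (C : Type w) [AddCommGroup C] [Module k C] [Module Λ C] [IsScalarTower k Λ C]
    [FiniteDimensional k C]
    (f : A →ₗ[Λ] ∀ i, Fin (n i) → V i) (g : (∀ i, Fin (n i) → V i) →ₗ[Λ] C) :
    (IsMinimalRightAlmostSplit k g →
      RightOmnipresentFrom ((mapT k g).restrictScalars k) ∧
      ForGeneralSubspaces k (fun U : ∀ i, Submodule k (V i) =>
        HasMaximalRank ((g.restrictScalars k).domRestrict (powSubspace n U))) ∧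
      (Function.Surjective g →
        Module.finrank k C < ∑ i, (Module.finrank k (V i)) ^ 2)) ∧
    (IsMinimalLeftAlmostSplit k f →
      RightOmnipresentInto ((mapS k f).restrictScalars k) ∧
      ForGeneralSubspaces k (fun U : ∀ i, Submodule k (V i) =>
        HasMaximalRank (powMkQ n U ∘ₗ f.restrictScalars k)) ∧
      (Function.Injective f →
        Module.finrank k A < ∑ i, (Module.finrank k (V i)) ^ 2)) ∧
    (IsAlmostSplitSequence k f g →
      (Module.finrank k (∀ i, Fin (n i) → V i) : ℤ) <
        2 * ∑ i, (Module.finrank k (V i) : ℤ) ^ 2 - 1) := by 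
  have : Infinite k := IsAlgClosed.instInfinite
  have right : IsMinimalRightAlmostSplit k g → _ := fun hg =>
    have h := hg.rightOmnipresentFrom
    And.intro h (And.intro (forGeneralSubspaces_domRestrict (g.restrictScalars k)
      h.comb_injective_or_surjective) (finrank_lt_of_rightOmnipresentFrom h hg.1.1))
  have left : IsMinimalLeftAlmostSplit k f → _ := fun hf =>
    have h := hf.rightOmnipresentInto
    And.intro h (And.intro (forGeneralSubspaces_powMkQ_comp (f.restrictScalars k)
      h.comb_injective_or_surjective) (finrank_lt_of_rightOmnipresentInto h hf.1.1))
  refine ⟨right, left, fun h => ?_⟩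
  have hA := (left h.isMinimalLeftAlmostSplit).2.2 h.1
  have hC := (right h.isMinimalRightAlmostSplit).2.2 h.2.2.1
  rw [h.finrank_eq]
  -- Both bounds are strict between integers, so the sum of the dimensions is at most `2 ∑ (dim Vᵢ)²
  -- - 2`.
  zify at hA hC
  push_cast
  linarith
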